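/- A hemiring is a commutative additive monoid $(R,+,0)$ with an associative multiplication that distributes over addition on both sides and satisfies $0r=0=r0$; it is a semiring if it has a multiplicative identity. Homomorphisms and congruences of hemirings are taken with respect to $+$, $\cdot$ and $0$ only. An ideal of a hemiring $R$ is an additive submonoid $I$ with $RI\subseteq I$ and $IR\subseteq I$; it is itself a hemiring. A nonzero semiring $S$ is ideal-simple if its only ideals are $0$ and $S$; it is simple if, moreover, its only congruences are the diagonal and the universal one. The Brown–McCoy radical $\mathcal{R}_{BM}(R)$ is the union of all ideals $I$ of $R$ such that the hemiring $I$ has no ideal-simple semiring as a homomorphic image. Let $\mathfrak{C}_s$ be the set of all congruences $\rho$ on $R$ such that $R/\rho$ is a simple semiring, and put $\mathcal{R}_{\mathfrak{C}_s}(R)=\bigcap_{\rho\in\mathfrak{C}_s}\{r\in R : (r,0)\in\rho\}$ (which is $R$ if $\mathfrak{C}_s=\emptyset$). A semiisomorphism is a surjective hemiring homomorphism $f$ with $\{r : f(r)=0\}=\{0\}$, and $R$ is semiisomorphic to $T$ if there is a semiisomorphism $R\to T$. A subdirect product of a (possibly empty) family $(R_i)_{i\in I}$ of hemirings is a subhemiring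 of $\prod_{i\in I}R_i$ that projects onto every $R_i$. Finally, $\mathbf{B}=\{0,1\}$ is the Boolean semifield, in which $1+1=1$. **Corollary 3.16.** For a commutative hemiring $R$ the following conditions are equivalent: (i) $\mathcal{R}_{BM}(R)=0$; (ii) $\mathcal{R}_{\mathfrak{C}_s}(R)=0$; (iii) $R$ is semiisomorphic to a subdirect product of simple commutative semirings; (iv) $R$ is semiisomorphic to a subdirect product of semirings each of which is either a field or (isomorphic to) the semifield $\mathbf{B}$. -/

import Mathlib

/-! Hemirings are Mathlib's `NonUnitalSemiring`s: a commutative additive monoid with an associative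
multiplication that distributes over addition on both sides and for which `0` is absorbing.
Hemiring homomorphisms are the maps `→ₙ+*`, congruences are `RingCon`. -/

namespace Hemiring

universe u

/-- The hemiring has a (two-sided) identity element, i.e. it is a semiring. -/
def HasIdentity (S : Type u) [NonUnitalSemiring S] : Prop :=
  ∃ e : S, ∀ x : S, e * x = x ∧ x * e = x

/-- A (two-sided) ideal of a hemiring: an additive submonoid that absorbs multiplication from both
sides. It is recorded as a subhemiring, so that it is a hemiring in its own right. -/
def IsIdeal {S : Type u} [NonUnitalSemiring S] (I : NonUnitalSubsemiring S) : Prop :=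
  ∀ (s : S), ∀ x ∈ I, s * x ∈ I ∧ x * s ∈ I

/-- A nonzero semiring whose only ideals are the zero ideal and the whole semiring. -/
def IsIdealSimpleSemiring (S : Type u) [NonUnitalSemiring S] : Prop :=
  Nontrivial S ∧ HasIdentity S ∧
    ∀ I : NonUnitalSubsemiring S, IsIdeal I → I = ⊥ ∨ I = ⊤

/-- The diagonal `⊥` and the universal congruence `⊤` are the only congruences. -/
def IsCongruenceSimple (S : Type u) [NonUnitalSemiring S] : Prop :=
  ∀ c : RingCon S, c = ⊥ ∨ c = ⊤

/-- A simple semiring: a nonzero semiring that is both ideal-simple and congruence-simple. -/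
def IsSimpleSemiring (S : Type u) [NonUnitalSemiring S] : Prop :=
  IsIdealSimpleSemiring S ∧ IsCongruenceSimple S

/-- Membership in the Brown-McCoy radical class: no homomorphic image is an ideal-simple (hence
nonzero) semiring. -/
def IsBrownMcCoyRadical (R : Type u) [NonUnitalSemiring R] : Prop :=
  ∀ (S : Type u) [NonUnitalSemiring S] (f : R →ₙ+* S),
    Function.Surjective f → ¬ IsIdealSimpleSemiring S

/-- The Brown-McCoy radical of `R`: the union of all ideals of `R` that, as hemirings, belong to
the Brown-McCoy radical class. -/
def brownMcCoyRadical (R : Type u) [NonUnitalSemiring R] : Set R :=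
  {r | ∃ I : NonUnitalSubsemiring R, IsIdeal I ∧ IsBrownMcCoyRadical I ∧ r ∈ I}

/-- The set of all congruences with a (nonzero) simple semiring as quotient. -/
def simpleCongruences (R : Type u) [NonUnitalSemiring R] : Set (RingCon R) :=
  {c | IsSimpleSemiring c.Quotient}

/-- The intersection of the kernels `{r | (r, 0) ∈ ρ}` of all congruences `ρ` with simple quotient;
it is all of `R` when there is no such congruence. -/
def congruenceKernelRadical (R : Type u) [NonUnitalSemiring R] : Set R :=
  ⋂ c ∈ simpleCongruences R, {r : R | c r 0}

/-- A semiisomorphism: a surjective homomorphism with zero kernel (not necessarily injective). -/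
def IsSemiisomorphism {R : Type u} {S : Type u} [NonUnitalSemiring R] [NonUnitalSemiring S]
    (f : R →ₙ+* S) : Prop :=
  Function.Surjective f ∧ ∀ r : R, f r = 0 → r = 0

/-- A subhemiring of a direct product is a subdirect product if it projects onto every factor. -/
def IsSubdirectProduct {ι : Type u} {S : ι → Type u} [∀ i, NonUnitalSemiring (S i)]
    (T : NonUnitalSubsemiring (∀ i, S i)) : Prop :=
  ∀ (i : ι) (s : S i), ∃ t ∈ T, t i = s

/-- `R` is semiisomorphic to a subdirect product of a (possibly empty) family of hemirings, each of
which has the property `P`. -/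
def SemiisomorphicToSubdirectProductOf
    (P : ∀ (S : Type u) [NonUnitalSemiring S], Prop) (R : Type u) [NonUnitalSemiring R] : Prop :=
  ∃ (ι : Type u) (S : ι → Type u) (_ : ∀ i, NonUnitalSemiring (S i)),
    (∀ i, P (S i)) ∧
      ∃ T : NonUnitalSubsemiring (∀ i, S i), IsSubdirectProduct T ∧
        ∃ f : R →ₙ+* T, IsSemiisomorphism f

/-- A simple commutative semiring. -/
def IsSimpleCommSemiring (S : Type u) [NonUnitalSemiring S] : Prop :=
  IsSimpleSemiring S ∧ ∀ x y : S, x * y = y * x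

/-- The carrier of the Boolean semifield `{0, 1}` with `1 + 1 = 1`. -/
inductive BooleanSemifield : Type
  | zero
  | one

namespace BooleanSemifield

/-- Addition, with `1 + 1 = 1`. -/
def add : BooleanSemifield → BooleanSemifield → BooleanSemifield
  | zero, y => y
  | one, _ => one

/-- Multiplication. -/
def mul : BooleanSemifield → BooleanSemifield → BooleanSemifield
  | zero, _ => zero
  | one, y => y

instance : Zero BooleanSemifield := ⟨zero⟩
instance : One BooleanSemifield := ⟨one⟩
instance : Add BooleanSemifield := ⟨add⟩
instance : Mul BooleanSemifield := ⟨mul⟩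

instance : CommSemiring BooleanSemifield where
  add_assoc a b c := by cases a <;> cases b <;> cases c <;> rfl
  zero_add a := by cases a <;> rfl
  add_zero a := by cases a <;> rfl
  add_comm a b := by cases a <;> cases b <;> rfl
  nsmul := nsmulRec
  left_distrib a b c := by cases a <;> cases b <;> cases c <;> rfl
  right_distrib a b c := by cases a <;> cases b <;> cases c <;> rfl
  zero_mul a := by cases a <;> rfl
  mul_zero a := by cases a <;> rfl
  mul_assoc a b c := by cases a <;> cases b <;> cases c <;> rfl
  one_mul a := by cases a <;> rfl
  mul_one a := by cases a <;> rfl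
  mul_comm a b := by cases a <;> cases b <;> rfl

end BooleanSemifield

/-- The hemiring `S` is (isomorphic to) a field or the Boolean semifield. -/
def IsFieldOrBoolean (S : Type u) [NonUnitalSemiring S] : Prop :=
  (∃ (K : Type u) (_ : Field K), Nonempty (S ≃+* K)) ∨ Nonempty (S ≃+* BooleanSemifield)

end Hemiring

/-! In a commutative ideal-simple semiring every nonzero element is a unit, and the additively
invertible elements form an ideal. So either it is a field, or only `0` has a negative; in the
latter case sending all nonzero elements to `1` is a homomorphism onto **B** with zero kernel
(`IsIdealSimpleSemiring.field_or_boolean`). Hence the simple commutative semirings are exactly the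
fields and **B**, and up to zero kernel ideal-simple images are no more general than simple ones. A
map from an ideal onto a semiring extends to the whole commutative hemiring
(`IsIdeal.exists_extension`), so both radicals coincide. Since these radicals only see zero classes,
the map into the product of all simple quotients has zero kernel but need not be injective. -/

namespace Hemiring

universe u v

/-! ### Kernel congruences and invariance of simplicity under isomorphism. -/

section Transport

variable {R : Type u} {S : Type v} [NonUnitalSemiring R] [NonUnitalSemiring S]

/-- The kernel congruence of a surjective homomorphism has the codomain as its quotient. -/
theorem nonempty_quotient_ker_equiv (f : R →ₙ+* S) (hf : Function.Surjective f) :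
    Nonempty (((⊥ : RingCon S).comap f).Quotient ≃+* S) := by
  refine ⟨RingEquiv.ofBijective
    ({ toFun := fun x => Quotient.liftOn' x f fun _ _ h => h
       map_zero' := map_zero f
       map_add' := fun x y => Quotient.inductionOn₂' x y fun a b => map_add f a b
       map_mul' := fun x y => Quotient.inductionOn₂' x y fun a b => map_mul f a b } :
      ((⊥ : RingCon S).comap f).Quotient →ₙ+* S) ⟨?_, ?_⟩⟩
  · intro x y
    induction x using Quotient.inductionOn'
    induction y using Quotient.inductionOn'
    exact fun h => Quotient.sound' h
  · intro s
    obtain ⟨r, rfl⟩ := hf s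
    exact ⟨Quotient.mk'' r, rfl⟩

theorem IsIdealSimpleSemiring.of_ringEquiv (e : R ≃+* S) (h : IsIdealSimpleSemiring S) :
    IsIdealSimpleSemiring R := by
  obtain ⟨_, ⟨u, hu⟩, hI⟩ := h
  refine ⟨e.toEquiv.nontrivial, ⟨e.symm u, fun x => ?_⟩, fun I hI' => ?_⟩
  · constructor <;> apply e.injective <;> simp [hu]
  · have key : IsIdeal (I.comap (e.symm : S →ₙ+* R)) := fun s x hx => by
      have := hI' (e.symm s) (e.symm x) hx
      exact ⟨by simpa using this.1, by simpa using this.2⟩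
    have mem : ∀ x, x ∈ I ↔ e x ∈ I.comap (e.symm : S →ₙ+* R) := fun x => by simp
    rcases hI _ key with h | h
    · left
      ext x
      rw [mem, h]
      simp [NonUnitalSubsemiring.mem_bot]
    · right
      ext x
      rw [mem, h]
      simp

theorem IsCongruenceSimple.of_ringEquiv (e : R ≃+* S) (h : IsCongruenceSimple S) :
    IsCongruenceSimple R := by
  intro c
  have rel : ∀ x y, c x y ↔ c.comap e.symm (e x) (e y) := fun x y => by
    simp [RingCon.comap_rel]
  rcases h (c.comap e.symm) with h | h
  · left
    ext x y
    rw [rel, h]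
    simp
  · right
    ext x y
    rw [rel, h]
    simp

theorem IsSimpleSemiring.of_ringEquiv (e : R ≃+* S) (h : IsSimpleSemiring S) :
    IsSimpleSemiring R :=
  ⟨h.1.of_ringEquiv e, h.2.of_ringEquiv e⟩

/-- A surjective homomorphism onto a simple semiring has its kernel among the congruences with
simple quotient. -/
theorem comap_bot_mem_simpleCongruences (f : R →ₙ+* S) (hf : Function.Surjective f)
    (h : IsSimpleSemiring S) : (⊥ : RingCon S).comap f ∈ simpleCongruences R := by
  obtain ⟨e⟩ := nonempty_quotient_ker_equiv f hf
  exact h.of_ringEquiv e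

end Transport

/-! ### Simple commutative semirings are fields or **B**. -/

section Semifields

/-- An ideal containing a nonzero `a` contains every `x = a * (b * x)`. The criterion serves fields
and **B** alike. -/
theorem IsIdealSimpleSemiring.of_forall_exists_mul_eq_one {S : Type u} [Semiring S] [Nontrivial S]
    (h : ∀ a : S, a ≠ 0 → ∃ b, a * b = 1) : IsIdealSimpleSemiring S := by
  refine ⟨inferInstance, ⟨1, fun x => ⟨one_mul x, mul_one x⟩⟩, fun I hI => ?_⟩
  by_cases hb : ∃ a ∈ I, a ≠ 0
  · right
    obtain ⟨a, ha, ha0⟩ := hb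
    obtain ⟨b, hab⟩ := h a ha0
    ext x
    have := (hI (b * x) a ha).2
    rw [← mul_assoc, hab, one_mul] at this
    simp [this]
  · left
    push Not at hb
    ext x
    exact ⟨fun hx => by simpa [NonUnitalSubsemiring.mem_bot] using hb x hx,
      fun hx => by rw [NonUnitalSubsemiring.mem_bot.1 hx]; exact I.zero_mem⟩

theorem IsSimpleSemiring.of_field (K : Type u) [Field K] : IsSimpleSemiring K := by
  refine ⟨.of_forall_exists_mul_eq_one fun a ha => ⟨a⁻¹, mul_inv_cancel₀ ha⟩, fun c => ?_⟩
  by_cases h : ∃ x y, c x y ∧ x ≠ y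
  · right
    obtain ⟨x, y, hxy, hne⟩ := h
    have h10 : c 1 0 := by
      -- Translating by `-y` and scaling by `(x - y)⁻¹` turns the pair `x`, `y` into `1`, `0`.
      have := c.mul (c.add hxy (c.refl (-y))) (c.refl (x - y)⁻¹)
      rwa [← sub_eq_add_neg, ← sub_eq_add_neg, sub_self, zero_mul,
        mul_inv_cancel₀ (sub_ne_zero.2 hne)] at this
    have h0 : ∀ z, c z 0 := fun z => by simpa using c.mul (c.refl z) h10
    ext a b
    simpa using c.trans (h0 a) (c.symm (h0 b))
  · left
    push Not at h
    ext a b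
    exact ⟨fun hab => h a b hab, fun hab => (show a = b from hab) ▸ c.refl a⟩

theorem BooleanSemifield.isSimpleSemiring : IsSimpleSemiring BooleanSemifield := by
  have : Nontrivial BooleanSemifield := ⟨⟨.zero, .one, by simp⟩⟩
  refine ⟨.of_forall_exists_mul_eq_one fun a ha => ⟨1, ?_⟩, fun c => ?_⟩
  · cases a
    · exact absurd rfl ha
    · rfl
  · by_cases h : c .zero .one
    · right
      ext a b
      cases a <;> cases b <;> simp [c.refl, h, c.symm h]
    · left
      have h' : ¬ c .one .zero := fun h' => h (c.symm h')
      ext a b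
      cases a <;> cases b <;> simp [c.refl, h, h']

theorem IsFieldOrBoolean.isSimpleSemiring {S : Type u} [NonUnitalSemiring S]
    (h : IsFieldOrBoolean S) : IsSimpleSemiring S := by
  rcases h with ⟨K, _, ⟨e⟩⟩ | ⟨⟨e⟩⟩
  · exact (IsSimpleSemiring.of_field K).of_ringEquiv e
  · exact BooleanSemifield.isSimpleSemiring.of_ringEquiv e

theorem IsFieldOrBoolean.mul_comm {S : Type u} [NonUnitalSemiring S]
    (h : IsFieldOrBoolean S) (x y : S) : x * y = y * x := by
  rcases h with ⟨K, _, ⟨e⟩⟩ | ⟨⟨e⟩⟩ <;> apply e.injective <;> simp [_root_.mul_comm]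

/-- The equation lets `inst` be substituted away, so that `CommSemiring` lemmas apply to the given
operations. -/
theorem HasIdentity.exists_commSemiring {S : Type u} [inst : NonUnitalSemiring S]
    (h : HasIdentity S) (hc : ∀ x y : S, x * y = y * x) :
    ∃ c : CommSemiring S, c.toNonUnitalSemiring = inst := by
  obtain ⟨e, he⟩ := h
  exact ⟨{ inst with
    one := e
    one_mul := fun x => (he x).1
    mul_one := fun x => (he x).2
    mul_comm := hc }, rfl⟩

/-- The principal ideal of `a` is nonzero, hence contains `1`. -/
theorem IsIdealSimpleSemiring.exists_mul_eq_one {S : Type u} [CommSemiring S]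
    (h : IsIdealSimpleSemiring S) {a : S} (ha : a ≠ 0) : ∃ b, a * b = 1 := by
  let I : NonUnitalSubsemiring S :=
    { carrier := {x | ∃ b, a * b = x}
      zero_mem' := ⟨0, mul_zero a⟩
      add_mem' := by
        rintro _ _ ⟨b, rfl⟩ ⟨c, rfl⟩
        exact ⟨b + c, mul_add a b c⟩
      mul_mem' := by
        rintro _ _ ⟨b, rfl⟩ ⟨c, rfl⟩
        exact ⟨b * (a * c), by ring⟩ }
  have hI : IsIdeal I := by
    rintro s _ ⟨b, rfl⟩
    exact ⟨⟨s * b, by ring⟩, ⟨s * b, by ring⟩⟩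
  have haI : a ∈ I := ⟨1, mul_one a⟩
  rcases h.2.2 I hI with h | h
  · rw [h] at haI
    exact absurd (NonUnitalSubsemiring.mem_bot.1 haI) ha
  · have : (1 : S) ∈ I := h ▸ NonUnitalSubsemiring.mem_top 1
    exact this

/-- In an ideal-simple commutative semiring either all elements are additively invertible or only
zero is. -/
theorem IsIdealSimpleSemiring.forall_exists_add_eq_zero_or {S : Type u} [CommSemiring S]
    (h : IsIdealSimpleSemiring S) :
    (∀ x : S, ∃ y, x + y = 0) ∨ ∀ x y : S, x + y = 0 → x = 0 := by
  let I : NonUnitalSubsemiring S :=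
    { carrier := {x | ∃ y, x + y = 0}
      zero_mem' := ⟨0, add_zero 0⟩
      add_mem' := by
        rintro a b ⟨c, hc⟩ ⟨d, hd⟩
        exact ⟨c + d, by rw [add_add_add_comm, hc, hd, add_zero]⟩
      mul_mem' := by
        rintro a b ⟨c, hc⟩ -
        exact ⟨c * b, by rw [← add_mul, hc, zero_mul]⟩ }
  have hI : IsIdeal I := by
    rintro s x ⟨y, hy⟩
    exact ⟨⟨s * y, by rw [← mul_add, hy, mul_zero]⟩, ⟨y * s, by rw [← add_mul, hy, zero_mul]⟩⟩
  rcases h.2.2 I hI with h | h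
  · right
    intro x y hxy
    have : x ∈ I := ⟨y, hxy⟩
    rw [h] at this
    exact NonUnitalSubsemiring.mem_bot.1 this
  · left
    intro x
    have : x ∈ I := h ▸ NonUnitalSubsemiring.mem_top x
    exact this

/-- Without congruence-simplicity the second case gives only a map onto **B**. It respects products
because nonzero elements are units, and sums because no nonzero element has a negative. -/
theorem IsIdealSimpleSemiring.field_or_boolean {S : Type u} [NonUnitalSemiring S]
    (h : IsIdealSimpleSemiring S) (hc : ∀ x y : S, x * y = y * x) :
    (∃ (K : Type u) (_ : Field K), Nonempty (S ≃+* K)) ∨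
      ∃ f : S →ₙ+* BooleanSemifield, Function.Surjective f ∧ ∀ x, f x = 0 → x = 0 := by
  classical
  obtain ⟨_, rfl⟩ := h.2.1.exists_commSemiring hc
  have := h.1
  rcases h.forall_exists_add_eq_zero_or with hneg | hzs
  · left
    choose neg hneg using hneg
    let _ : CommRing S :=
      { ‹CommSemiring S› with
        neg := neg
        zsmul := letI : Neg S := ⟨neg⟩; zsmulRec
        neg_add_cancel := fun a => by rw [add_comm]; exact hneg a }
    have hF : IsField S := ⟨exists_pair_ne S, mul_comm, fun ha => h.exists_mul_eq_one ha⟩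
    exact ⟨S, hF.toField, ⟨RingEquiv.refl S⟩⟩
  · right
    have h01 : (1 : BooleanSemifield) ≠ 0 := fun h => BooleanSemifield.noConfusion h
    have h11 : (1 : BooleanSemifield) + 1 = 1 := rfl
    refine ⟨{ toFun := fun x => if x = 0 then 0 else 1
              map_zero' := if_pos rfl
              map_add' := fun x y => ?_
              map_mul' := fun x y => ?_ }, ?_, ?_⟩
    · by_cases hx : x = 0
      · simp [hx]
      · by_cases hy : y = 0
        · simp [hy]
        · have : x * y ≠ 0 := fun hxy => by
            obtain ⟨z, hz⟩ := h.exists_mul_eq_one hx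
            apply hy
            rw [← one_mul y, ← hz, mul_right_comm, hxy, zero_mul]
          simp [hx, hy, this]
    · by_cases hx : x = 0
      · simp [hx]
      · by_cases hy : y = 0
        · simp [hy]
        · have : x + y ≠ 0 := fun hxy => hx (hzs x y hxy)
          simp [hx, hy, this, h11]
    · rintro (_ | _)
      · exact ⟨0, if_pos rfl⟩
      · exact ⟨1, if_neg one_ne_zero⟩
    · intro x hx
      by_contra hx0
      exact h01 ((if_neg hx0).symm.trans hx)

/-- The kernel congruence of the map onto **B** separates preimages of `0` and `1`, so it is the
diagonal and the map is injective. -/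
theorem IsSimpleCommSemiring.isFieldOrBoolean {S : Type u} [NonUnitalSemiring S]
    (h : IsSimpleCommSemiring S) : IsFieldOrBoolean S := by
  rcases h.1.1.field_or_boolean h.2 with hK | ⟨f, hf, -⟩
  · exact .inl hK
  · right
    obtain ⟨x, hx⟩ := hf 0
    obtain ⟨y, hy⟩ := hf 1
    have h01 : (0 : BooleanSemifield) ≠ 1 := fun h => BooleanSemifield.noConfusion h
    rcases h.1.2 ((⊥ : RingCon BooleanSemifield).comap f) with hc | hc
    · refine ⟨RingEquiv.ofBijective f ⟨fun a b hab => ?_, hf⟩⟩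
      have : (⊥ : RingCon BooleanSemifield).comap f a b := hab
      rw [hc] at this
      exact this
    · have : (⊥ : RingCon BooleanSemifield).comap f x y := by rw [hc]; trivial
      exact absurd (hx.symm.trans (Eq.trans this hy)) h01

theorem isSimpleCommSemiring_iff_isFieldOrBoolean {S : Type u} [NonUnitalSemiring S] :
    IsSimpleCommSemiring S ↔ IsFieldOrBoolean S :=
  ⟨fun h => h.isFieldOrBoolean, fun h => ⟨h.isSimpleSemiring, h.mul_comm⟩⟩

end Semifields

/-! ### Comparison of the two radicals. -/

section Radicals

/-- A surjective homomorphism from an ideal of a commutative hemiring onto a semiring extends to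
the whole hemiring. -/
theorem IsIdeal.exists_extension {R : Type u} [NonUnitalCommSemiring R]
    {I : NonUnitalSubsemiring R} (hI : IsIdeal I) {S : Type v} [NonUnitalSemiring S]
    (f : I →ₙ+* S) (hf : Function.Surjective f) (hS : HasIdentity S) :
    ∃ g : R →ₙ+* S, ∀ x : I, g x = f x := by
  obtain ⟨u, hu⟩ := hS
  obtain ⟨e, rfl⟩ := hf u
  have hmem : ∀ r : R, r * e ∈ I := fun r => (hI r e e.2).1
  -- The formula is forced: as `f e` is the identity, an extension `g` has `g r = g r * g e = f (r *
  -- e)`.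
  refine ⟨{ toFun := fun r => f ⟨r * e, hmem r⟩
            map_zero' := ?_
            map_add' := fun r s => ?_
            map_mul' := fun r s => ?_ }, fun x => ?_⟩
  -- A spare factor `f e` is inserted, and `r * s * e * e = r * e * (s * e)` by commutativity.
  · rw [← (hu (f ⟨r * s * e, hmem _⟩)).2, ← map_mul, ← map_mul]
    congr 1
    apply Subtype.ext
    change r * s * e * (e : R) = r * e * (s * e)
    rw [mul_mul_mul_comm, mul_assoc]
  · rw [← map_zero f]
    congr 1
    exact Subtype.ext (zero_mul _)
  · rw [← map_add]
    congr 1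
    exact Subtype.ext (add_mul _ _ _)
  · change f ⟨x * e, hmem x⟩ = f x
    rw [← (hu (f x)).2, ← map_mul]
    rfl

/-- If an ideal of a commutative hemiring maps onto an ideal-simple semiring, then the whole
hemiring has a congruence with simple quotient whose zero class meets the ideal only in the kernel
of that map. -/
theorem IsIdeal.exists_mem_simpleCongruences {R : Type u} [NonUnitalCommSemiring R]
    {I : NonUnitalSubsemiring R} (hI : IsIdeal I) {S : Type u} [NonUnitalSemiring S]
    (f : I →ₙ+* S) (hf : Function.Surjective f) (hS : IsIdealSimpleSemiring S) :
    ∃ c ∈ simpleCongruences R, ∀ x : I, c x 0 → f x = 0 := by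
  have hc : ∀ x y : S, x * y = y * x := hf.forall₂.2 fun x y => by
    rw [← map_mul, ← map_mul]
    congr 1
    exact Subtype.ext (mul_comm _ _)
  obtain ⟨g, hg⟩ := hI.exists_extension f hf hS.2.1
  have hgs : Function.Surjective g := fun s => by
    obtain ⟨x, rfl⟩ := hf s
    exact ⟨x, hg x⟩
  rcases hS.field_or_boolean hc with ⟨K, _, ⟨e⟩⟩ | ⟨q, hq, hq0⟩
  · exact ⟨_, comap_bot_mem_simpleCongruences g hgs
      ((IsSimpleSemiring.of_field K).of_ringEquiv e),
      fun x hx => (hg x).symm.trans ((show g x = g 0 from hx).trans (map_zero g))⟩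
  -- Here `S` need not be congruence-simple; passing on to **B** repairs this, and `q` has zero
  -- kernel.
  · refine ⟨_, comap_bot_mem_simpleCongruences (q.comp g) (hq.comp hgs)
      BooleanSemifield.isSimpleSemiring, fun x hx => hq0 _ ?_⟩
    rw [← hg x]
    exact (show q.comp g x = q.comp g 0 from hx).trans (map_zero (q.comp g))

/-- The intersection of the zero classes of all congruences with simple quotient, as a
subhemiring. -/
def congruenceKernelIdeal (R : Type u) [NonUnitalSemiring R] : NonUnitalSubsemiring R where
  carrier := congruenceKernelRadical R
  zero_mem' := Set.mem_iInter₂.2 fun c _ => c.refl 0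
  add_mem' {a b} ha hb := Set.mem_iInter₂.2 fun c hc => by
    simpa using c.add (Set.mem_iInter₂.1 ha c hc) (Set.mem_iInter₂.1 hb c hc)
  mul_mem' {a b} ha hb := Set.mem_iInter₂.2 fun c hc => by
    simpa using c.mul (Set.mem_iInter₂.1 ha c hc) (Set.mem_iInter₂.1 hb c hc)

theorem isIdeal_congruenceKernelIdeal (R : Type u) [NonUnitalSemiring R] :
    IsIdeal (congruenceKernelIdeal R) := fun s _ hx =>
  ⟨Set.mem_iInter₂.2 fun c hc => by
      simpa using c.mul (c.refl s) (Set.mem_iInter₂.1 hx c hc),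
    Set.mem_iInter₂.2 fun c hc => by
      simpa using c.mul (Set.mem_iInter₂.1 hx c hc) (c.refl s)⟩

/-- The image of a radical ideal in a simple quotient is an ideal. It is not the whole quotient, so
it is zero. -/
theorem brownMcCoyRadical_subset_congruenceKernelRadical (R : Type u) [NonUnitalSemiring R] :
    brownMcCoyRadical R ⊆ congruenceKernelRadical R := by
  rintro r ⟨I, hI, hrad, hr⟩
  refine Set.mem_iInter₂.2 fun c hc => ?_
  let p : I →ₙ+* c.Quotient :=
    { toFun := fun x => ((x : R) : c.Quotient)
      map_zero' := rfl
      map_add' := fun _ _ => rfl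
      map_mul' := fun _ _ => rfl }
  have hp : IsIdeal (NonUnitalRingHom.srange p) := by
    rintro s _ ⟨x, rfl⟩
    induction s using Quotient.inductionOn' with
    | h s => exact ⟨⟨⟨s * x, (hI s x x.2).1⟩, rfl⟩, ⟨⟨x * s, (hI s x x.2).2⟩, rfl⟩⟩
  rcases hc.1.2.2 _ hp with h | h
  · have hpr : p ⟨r, hr⟩ ∈ NonUnitalRingHom.srange p := ⟨_, rfl⟩
    rw [h] at hpr
    exact c.eq.1 (NonUnitalSubsemiring.mem_bot.1 hpr)
  · exact absurd hc.1 (hrad _ p (NonUnitalRingHom.srange_eq_top_iff_surjective.1 h))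

/-- The intersection of the zero classes is itself a radical ideal: a map of it onto an ideal-simple
semiring would vanish on it. -/
theorem congruenceKernelRadical_subset_brownMcCoyRadical (R : Type u) [NonUnitalCommSemiring R] :
    congruenceKernelRadical R ⊆ brownMcCoyRadical R := fun r hr => by
  refine ⟨congruenceKernelIdeal R, isIdeal_congruenceKernelIdeal R, fun S _ f hf hS => ?_, hr⟩
  obtain ⟨c, hc, h⟩ := (isIdeal_congruenceKernelIdeal R).exists_mem_simpleCongruences f hf hS
  have := hS.1
  obtain ⟨s, hs⟩ := exists_ne (0 : S)
  obtain ⟨x, rfl⟩ := hf s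
  exact hs (h x (Set.mem_iInter₂.1 x.2 c hc))

/-- For commutative hemirings the Brown-McCoy radical is determined by the simple quotients. -/
theorem brownMcCoyRadical_eq_congruenceKernelRadical (R : Type u) [NonUnitalCommSemiring R] :
    brownMcCoyRadical R = congruenceKernelRadical R :=
  (brownMcCoyRadical_subset_congruenceKernelRadical R).antisymm
    (congruenceKernelRadical_subset_brownMcCoyRadical R)

end Radicals

/-! ### Subdirect representations. -/

section SubdirectProducts

theorem SemiisomorphicToSubdirectProductOf.mono
    {P Q : ∀ (S : Type u) [NonUnitalSemiring S], Prop} {R : Type u} [NonUnitalSemiring R]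
    (hPQ : ∀ (S : Type u) [NonUnitalSemiring S], P S → Q S)
    (h : SemiisomorphicToSubdirectProductOf P R) : SemiisomorphicToSubdirectProductOf Q R := by
  obtain ⟨ι, S, _, hS, T, hT, f, hf⟩ := h
  exact ⟨ι, S, _, fun i => hPQ _ (hS i), T, hT, f, hf⟩

theorem congruenceKernelRadical_eq_singleton_zero_of_subdirect {R : Type u} [NonUnitalSemiring R]
    (h : SemiisomorphicToSubdirectProductOf IsSimpleCommSemiring R) :
    congruenceKernelRadical R = {0} := by
  obtain ⟨ι, S, _, hS, T, hT, f, hf, hf0⟩ := h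
  refine Set.Subset.antisymm (fun r hr => hf0 r ?_)
    (Set.singleton_subset_iff.2 (congruenceKernelIdeal R).zero_mem)
  apply Subtype.ext
  funext i
  let p : R →ₙ+* S i :=
    { toFun := fun r => (f r : ∀ i, S i) i
      map_zero' := by simp
      map_add' := fun _ _ => by simp
      map_mul' := fun _ _ => by simp }
  have hp : Function.Surjective p := fun s => by
    obtain ⟨t, ht, rfl⟩ := hT i s
    obtain ⟨r, hr⟩ := hf ⟨t, ht⟩
    exact ⟨r, congrFun (congrArg Subtype.val hr) i⟩
  -- Each coordinate map is onto a simple semiring, so its kernel congruence is one of those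
  -- intersected.
  have := Set.mem_iInter₂.1 hr _ (comap_bot_mem_simpleCongruences p hp (hS i).1)
  exact (show p r = p 0 from this).trans (map_zero p)

theorem subdirect_of_congruenceKernelRadical_eq_singleton_zero
    {R : Type u} [NonUnitalCommSemiring R] (h : congruenceKernelRadical R = {0}) :
    SemiisomorphicToSubdirectProductOf IsSimpleCommSemiring R := by
  let p : R →ₙ+* (∀ c : simpleCongruences R, c.1.Quotient) :=
    { toFun := fun r c => (r : c.1.Quotient)
      map_zero' := rfl
      map_add' := fun _ _ => rfl
      map_mul' := fun _ _ => rfl }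
  refine ⟨simpleCongruences R, fun c => c.1.Quotient, fun _ => inferInstance,
    fun c => ⟨c.2, mul_comm⟩, NonUnitalRingHom.srange p, fun c s => ?_,
    NonUnitalRingHom.srangeRestrict p, NonUnitalRingHom.srangeRestrict_surjective p,
    fun r hr => ?_⟩
  · induction s using Quotient.inductionOn' with
    | h s => exact ⟨p s, ⟨s, rfl⟩, rfl⟩
  · have hmem : r ∈ congruenceKernelRadical R := Set.mem_iInter₂.2 fun c hc =>
      c.eq.1 (congrFun (congrArg Subtype.val hr) ⟨c, hc⟩)
    rwa [h] at hmem

end SubdirectProducts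

end Hemiring

theorem corollary3p16 {R : Type*} [NonUnitalCommSemiring R] :
    [Hemiring.brownMcCoyRadical R = {0},
      Hemiring.congruenceKernelRadical R = {0},
      Hemiring.SemiisomorphicToSubdirectProductOf Hemiring.IsSimpleCommSemiring R,
      Hemiring.SemiisomorphicToSubdirectProductOf Hemiring.IsFieldOrBoolean R].TFAE := by
  tfae_have 1 ↔ 2 := by rw [Hemiring.brownMcCoyRadical_eq_congruenceKernelRadical]
  tfae_have 2 → 3 := Hemiring.subdirect_of_congruenceKernelRadical_eq_singleton_zero
  tfae_have 3 → 2 := Hemiring.congruenceKernelRadical_eq_singleton_zero_of_subdirect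
  tfae_have 3 → 4 := .mono fun _ _ => Hemiring.isSimpleCommSemiring_iff_isFieldOrBoolean.1
  tfae_have 4 → 3 := .mono fun _ _ => Hemiring.isSimpleCommSemiring_iff_isFieldOrBoolean.2
  tfae_finish
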